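/- Let $\mathcal X\subset\mathbb R^d$ be compact, let $k:\mathcal X\times\mathcal X\to\mathbb R$ be a (measurable) positive semidefinite kernel with $k(x,x')\le 1$ for all $x,x'\in\mathcal X$, and let $f$ belong to the reproducing kernel Hilbert space $\mathcal H_k$ of $k$ with $\|f\|_k\le B$. Let $(\mathcal F_t)_{t\ge 0}$ be a filtration on a probability space. In round $t=1,\dots,T$ (with $T\ge1$) an $\mathcal F_{t-1}$-measurable point $x_t\in\mathcal X$ is queried and $y_t=f(x_t)+\epsilon_t$ is observed, where $\epsilon_t$ is $\mathcal F_t$-measurable and conditionally $R$-sub-Gaussian: $\mathbb E[\exp(\eta\epsilon_t)\mid\mathcal F_{t-1}]\le\exp(\eta^2R^2/2)$ for all $\eta\in\mathbb R$. Let $\sigma>0$ with $0\le R\le\sigma$, and let $$\mu_{t-1}(x)=\mathbf k_{t-1}(x)^\top(\mathbf K_{t-1}+\sigma^2\mathbf I)^{-1}\mathbf y_{t-1},\qquad \sigma_{t-1}^2(x)=k(x,x)-\mathbf k_{t-1}(x)^\top(\mathbf K_{t-1}+\sigma^2\mathbf I)^{-1}\mathbf k_{t-1}(x)$$ be the Gaussian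 process predictive mean and variance, where $\mathbf K_{t-1}=[k(x_i,x_j)]_{i,j=1}^{t-1}$, $\mathbf k_{t-1}(x)=[k(x_i,x)]_{i=1}^{t-1}$ and $\mathbf y_{t-1}=(y_1,\dots,y_{t-1})^\top$. Let $$\gamma_t=\sup_{a_1,\dots,a_t\in\mathcal X}\tfrac12\log\det\bigl(\mathbf I+\sigma^{-2}[k(a_i,a_j)]_{i,j=1}^t\bigr)$$ be the maximum information gain. Fix $\delta\in(0,1)$ and let $\beta_1,\dots,\beta_T$ be real numbers with $$\beta_t\ \ge\ 2B^2+300\,\gamma_t\,\log^3(t/\delta),\qquad 1\le t\le T$$ (for instance with equality). Suppose that the queries are those of GP-UCB with the fixed kernel $k$, i.e. $x_t\in\arg\max_{x\in\mathcal X}\ \mu_{t-1}(x)+\beta_t^{1/2}\sigma_{t-1}(x)$ for $1\le t\le T$. Put $C_t^f(x)=\{z\in\mathbb R:|z-\mu_{t-1}(x)|\le\beta_t^{1/2}\sigma_{t-1}(x)\}$ and $$\hat p_T^f=\frac1T\sum_{t=1}^T\mathbb 1\bigl[f(x_t)\in C_t^f(x_t)\bigr].$$ Then $\mathbb P\bigl(\hat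 p_T^f\ge 1-\delta\bigr)\ge 1-\delta$. -/

import Mathlib

open MeasureTheory ProbabilityTheory
open scoped Matrix

noncomputable section

namespace GPUCB

variable {X : Type*}

/-- The Gram matrix `K = [k(a_i, a_j)]` of a tuple of points. -/
def gram (k : X → X → ℝ) {n : ℕ} (a : Fin n → X) : Matrix (Fin n) (Fin n) ℝ :=
  Matrix.of fun i j => k (a i) (a j)

/-- The regularised Gram matrix `K + σ² I`. -/
def regGram (k : X → X → ℝ) (σ : ℝ) {n : ℕ} (a : Fin n → X) : Matrix (Fin n) (Fin n) ℝ :=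
  gram k a + σ ^ 2 • (1 : Matrix (Fin n) (Fin n) ℝ)

/-- The vector `k(z) = [k(a_i, z)]`. -/
def kvec (k : X → X → ℝ) {n : ℕ} (a : Fin n → X) (z : X) : Fin n → ℝ :=
  fun i => k (a i) z

/-- GP predictive mean `k(z)ᵀ (K + σ² I)⁻¹ y` after observing `y` at the points `a`. -/
def postMean (k : X → X → ℝ) (σ : ℝ) {n : ℕ} (a : Fin n → X) (y : Fin n → ℝ) (z : X) : ℝ :=
  kvec k a z ⬝ᵥ ((regGram k σ a)⁻¹ *ᵥ y)

/-- GP predictive variance `k(z, z) - k(z)ᵀ (K + σ² I)⁻¹ k(z)`. -/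
def postVar (k : X → X → ℝ) (σ : ℝ) {n : ℕ} (a : Fin n → X) (z : X) : ℝ :=
  k z z - kvec k a z ⬝ᵥ ((regGram k σ a)⁻¹ *ᵥ kvec k a z)

/-- GP predictive standard deviation. -/
def postStd (k : X → X → ℝ) (σ : ℝ) {n : ℕ} (a : Fin n → X) (z : X) : ℝ :=
  √(postVar k σ a z)

/-- Maximum information gain after `t` evaluations: the supremum of `½ log det (I + σ⁻² K_A)` over
all choices `A` of `t` points, repetitions allowed. For a positive semidefinite kernel with
`k ≤ 1` it is at most `½ t log (1 + σ⁻²)`, so the supremum is a genuine one. -/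
def infoGain (k : X → X → ℝ) (σ : ℝ) (t : ℕ) : ℝ :=
  ⨆ a : Fin t → X,
    (1 / 2) * Real.log (1 + (σ ^ 2)⁻¹ • gram k a : Matrix (Fin t) (Fin t) ℝ).det

/-- The exploration scale `2 B² + 300 γ_t log³(t / δ)`. -/
def ucbScale (k : X → X → ℝ) (σ B δ : ℝ) (t : ℕ) : ℝ :=
  2 * B ^ 2 + 300 * infoGain k σ t * Real.log (t / δ) ^ 3

variable {Ω : Type*}

/-- The first `n` queries `x_1, …, x_n` along the outcome `ω`. -/
def queries (x : ℕ → Ω → X) (n : ℕ) (ω : Ω) : Fin n → X :=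
  fun i => x (i + 1) ω

/-- The first `n` observations `y_i = f(x_i) + ε_i`, `1 ≤ i ≤ n`, along the outcome `ω`. -/
def observations (f : X → ℝ) (x : ℕ → Ω → X) (ε : ℕ → Ω → ℝ) (n : ℕ) (ω : Ω) : Fin n → ℝ :=
  fun i => f (x (i + 1) ω) + ε (i + 1) ω

/-- `μ_{t-1}(z)` at round `t` of a run (for `t ≥ 1`). -/
def runMean (k : X → X → ℝ) (σ : ℝ) (f : X → ℝ) (x : ℕ → Ω → X) (ε : ℕ → Ω → ℝ)
    (t : ℕ) (ω : Ω) (z : X) : ℝ :=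
  postMean k σ (queries x (t - 1) ω) (observations f x ε (t - 1) ω) z

/-- `σ_{t-1}(z)` at round `t` of a run (for `t ≥ 1`). -/
def runStd (k : X → X → ℝ) (σ : ℝ) (x : ℕ → Ω → X) (t : ℕ) (ω : Ω) (z : X) : ℝ :=
  postStd k σ (queries x (t - 1) ω) z

/-- In each of the rounds `1, …, T` the query maximises the upper confidence bound
`z ↦ μ_{t-1}(z) + √β_t σ_{t-1}(z)`. -/
def IsUCBRun (k : X → X → ℝ) (σ : ℝ) (β : ℕ → ℝ) (f : X → ℝ) (x : ℕ → Ω → X)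
    (ε : ℕ → Ω → ℝ) (T : ℕ) : Prop :=
  ∀ t ∈ Finset.Icc 1 T, ∀ ω, ∀ z : X,
    runMean k σ f x ε t ω z + √(β t) * runStd k σ x t ω z ≤
      runMean k σ f x ε t ω (x t ω) + √(β t) * runStd k σ x t ω (x t ω)

/-- The noise `ε_1, …, ε_T` is adapted and conditionally `R`-sub-Gaussian:
`E[exp(η ε_t) | ℱ_{t-1}] ≤ exp(η² R² / 2)` for all real `η`. -/
def IsCondSubGaussianNoise {mΩ : MeasurableSpace Ω} (P : Measure Ω) (ℱ : Filtration ℕ mΩ) (R : ℝ)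
    (ε : ℕ → Ω → ℝ) (T : ℕ) : Prop :=
  ∀ t ∈ Finset.Icc 1 T, Measurable[ℱ t] (ε t) ∧
    ∀ η : ℝ, Integrable (fun ω => Real.exp (η * ε t ω)) P ∧
      P[fun ω => Real.exp (η * ε t ω) | ℱ (t - 1)] ≤ᵐ[P] fun _ => Real.exp (η ^ 2 * R ^ 2 / 2)

/-- The function-level set `C_t^f(v) = {z : |z - μ_{t-1}(v)| ≤ √β_t σ_{t-1}(v)}`. -/
def coverageSet (k : X → X → ℝ) (σ : ℝ) (β : ℕ → ℝ) (f : X → ℝ) (x : ℕ → Ω → X)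
    (ε : ℕ → Ω → ℝ) (t : ℕ) (ω : Ω) (v : X) : Set ℝ :=
  {z | |z - runMean k σ f x ε t ω v| ≤ √(β t) * runStd k σ x t ω v}

/-- The function-level long-run coverage `(1 / T) ∑_{t=1}^T 𝟙[f(x_t) ∈ C_t^f(x_t)]`. -/
def coverage (k : X → X → ℝ) (σ : ℝ) (β : ℕ → ℝ) (f : X → ℝ) (x : ℕ → Ω → X)
    (ε : ℕ → Ω → ℝ) (T : ℕ) (ω : Ω) : ℝ :=
  (1 / (T : ℝ)) * ∑ t ∈ Finset.Icc 1 T,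
    (coverageSet k σ β f x ε t ω (x t ω)).indicator (fun _ => (1 : ℝ)) (f (x t ω))

end GPUCB

end

/-!
Write `Φ w = ∑ wᵢ φ(xᵢ)` for the queried features and `ε` for the noise. The predictive mean
misses `f = ⟨g, φ(·)⟩` at `z` by a bias of at most `‖g‖ σ_{t-1}(z)` plus a noise term of at most
`√Z / σ * σ_{t-1}(z)`, where `Z = εᵀ K (K + σ² I)⁻¹ ε` is the self-normalised noise. So the
confidence sets cover `f` at all points at once as soon as `Z / σ²` is at most
`150 γ_t log³(t / δ)`.

Averaging exponential martingales over a Gaussian parameter (the method of mixtures) shows that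
`exp ((Z / σ² - log det (I + σ⁻² K)) / 2)` has expectation at most one: in each round it is
multiplied by a factor which is a Gaussian average of the sub-Gaussian factors of the new noise
variable. Markov's inequality then gives `Z / σ² ≤ 2 γ + 2 u` outside an event of probability
`exp (-u)`.

This is not proportional to `γ` when `γ` is small. But then `tr K ≤ 4 γ σ²`, and the same mixture
with the smaller regulariser `4 γ σ²` in place of `σ²` has log determinant at most one; comparing
the two self-normalised norms bounds `Z / σ²` by `8 γ (1 + 2 u)`. With `u = 2 log (t / δ)` the
failure probabilities of the rounds `t ≥ 2` are `(δ / t)²`, which sum to at most `δ`, while round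
one starts without noise.
-/

namespace GPUCB

section Matrix

lemma one_add_sum_le_prod_one_add {ι : Type*} (s : Finset ι) {f : ι → ℝ}
    (hf : ∀ i ∈ s, 0 ≤ f i) : 1 + ∑ i ∈ s, f i ≤ ∏ i ∈ s, (1 + f i) := by
  induction s using Finset.cons_induction with
  | empty => simp
  | cons j s hj ih =>
    rw [Finset.forall_mem_cons] at hf
    rw [Finset.sum_cons, Finset.prod_cons]
    nlinarith [ih hf.2, mul_nonneg hf.1 (Finset.sum_nonneg hf.2)]

variable {ι : Type*} [Fintype ι] [DecidableEq ι] {A : Matrix ι ι ℝ}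

lemma det_one_add_eq_prod_eigenvalues (hA : A.IsHermitian) :
    (1 + A).det = ∏ i, (1 + hA.eigenvalues i) := by
  have h := congrArg (Polynomial.eval (-1)) hA.charpoly_eq
  have hscalar : Matrix.scalar ι (-1 : ℝ) - A = -(1 + A) := by
    rw [map_neg, map_one, neg_add']
  have hprod : ∏ i, (-1 - hA.eigenvalues i)
      = (-1) ^ Fintype.card ι * ∏ i, (1 + hA.eigenvalues i) := by
    simp only [← neg_add', Finset.prod_neg, Finset.card_univ]
  simp only [Matrix.eval_charpoly, Polynomial.eval_prod, Polynomial.eval_sub, Polynomial.eval_X,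
    Polynomial.eval_C, RCLike.ofReal_real_eq_id, id, hscalar, Matrix.det_neg, hprod] at h
  exact mul_left_cancel₀ (pow_ne_zero _ (neg_ne_zero.2 one_ne_zero)) h

lemma one_add_trace_le_det_one_add (hA : A.PosSemidef) : 1 + A.trace ≤ (1 + A).det := by
  rw [det_one_add_eq_prod_eigenvalues hA.isHermitian, hA.isHermitian.trace_eq_sum_eigenvalues]
  exact one_add_sum_le_prod_one_add _ fun i _ => hA.eigenvalues_nonneg i

lemma det_one_add_le_exp_trace (hA : A.PosSemidef) : (1 + A).det ≤ Real.exp A.trace := by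
  rw [det_one_add_eq_prod_eigenvalues hA.isHermitian, hA.isHermitian.trace_eq_sum_eigenvalues]
  exact Real.prod_one_add_le_exp_sum _ hA.eigenvalues_nonneg

end Matrix

section RidgeRegression

variable {X H : Type*} [NormedAddCommGroup H] [InnerProductSpace ℝ H]

/-- `φ` is a feature map of the kernel `k`: all that the regression argument needs of the
reproducing kernel Hilbert space, where `φ z` is the kernel section at `z`. -/
def IsFeatureMap (k : X → X → ℝ) (φ : X → H) : Prop :=
  ∀ z z', k z z' = inner ℝ (φ z) (φ z')

/-- The synthesis operator `w ↦ ∑ wᵢ φ(aᵢ)` of the features at the points `a`, whose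
Gram operator in coordinates is the kernel matrix. -/
def synthesis (φ : X → H) {n : ℕ} (a : Fin n → X) : (Fin n → ℝ) →ₗ[ℝ] H :=
  Fintype.linearCombination ℝ (φ ∘ a)

/-- The coefficients `(K + s² I)⁻¹ y` of kernel ridge regression. -/
noncomputable def ridgeCoef (k : X → X → ℝ) (s : ℝ) {n : ℕ} (a : Fin n → X) (y : Fin n → ℝ) :
    Fin n → ℝ :=
  (regGram k s a)⁻¹ *ᵥ y

/-- The squared self-normalised norm `eᵀ K (K + s² I)⁻¹ e` of the noise vector `e`. In terms of the
synthesis operator `Φ` it is the square of `‖Φ e‖` for the norm of `(Φ Φᵀ + s²)⁻¹`. -/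
noncomputable def selfNormSq (k : X → X → ℝ) (s : ℝ) {n : ℕ} (a : Fin n → X) (e : Fin n → ℝ) :
    ℝ :=
  e ⬝ᵥ (gram k a *ᵥ ridgeCoef k s a e)

/-- The determinant `det (I + s⁻² K)`, whose half logarithm is the information gain of the
points `a`. -/
noncomputable def gainDet (k : X → X → ℝ) (s : ℝ) {n : ℕ} (a : Fin n → X) : ℝ :=
  (1 + (s ^ 2)⁻¹ • gram k a : Matrix (Fin n) (Fin n) ℝ).det

variable {k : X → X → ℝ} {φ : X → H} {s : ℝ} {n : ℕ}

lemma inner_synthesis_left (a : Fin n → X) (w : Fin n → ℝ) (h : H) :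
    inner ℝ (synthesis φ a w) h = w ⬝ᵥ fun i => inner ℝ (φ (a i)) h := by
  simp [synthesis, Fintype.linearCombination_apply, sum_inner, inner_smul_left, dotProduct]

lemma trace_gram (a : Fin n → X) : (gram k a).trace = ∑ i, k (a i) (a i) := rfl

namespace IsFeatureMap

lemma comm (hφ : IsFeatureMap k φ) (z z' : X) : k z z' = k z' z := by
  rw [hφ, hφ, real_inner_comm]

lemma posSemidef_gram (hφ : IsFeatureMap k φ) (a : Fin n → X) : (gram k a).PosSemidef := by
  have h : gram k a = Matrix.gram ℝ (φ ∘ a) := Matrix.ext fun i j => hφ (a i) (a j)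
  exact h ▸ Matrix.posSemidef_gram ℝ _

lemma posSemidef_smul_gram (hφ : IsFeatureMap k φ) (s : ℝ) (a : Fin n → X) :
    ((s ^ 2)⁻¹ • gram k a).PosSemidef :=
  (hφ.posSemidef_gram a).smul (inv_nonneg.2 (sq_nonneg s))

lemma posDef_regGram (hφ : IsFeatureMap k φ) (hs : 0 < s) (a : Fin n → X) :
    (regGram k s a).PosDef :=
  Matrix.PosDef.posSemidef_add (hφ.posSemidef_gram a) (Matrix.PosDef.one.smul (pow_pos hs 2))

lemma isUnit_det_regGram (hφ : IsFeatureMap k φ) (hs : 0 < s) (a : Fin n → X) :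
    IsUnit (regGram k s a).det :=
  (hφ.posDef_regGram hs a).det_pos.ne'.isUnit

lemma gram_mulVec (hφ : IsFeatureMap k φ) (a : Fin n → X) (w : Fin n → ℝ) :
    gram k a *ᵥ w = fun i => inner ℝ (φ (a i)) (synthesis φ a w) := by
  ext i
  rw [real_inner_comm, inner_synthesis_left, Matrix.mulVec, dotProduct_comm]
  simp only [gram, Matrix.of_apply, hφ (a i), real_inner_comm]

lemma dotProduct_gram_mulVec (hφ : IsFeatureMap k φ) (a : Fin n → X) (v w : Fin n → ℝ) :
    v ⬝ᵥ (gram k a *ᵥ w) = inner ℝ (synthesis φ a v) (synthesis φ a w) := by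
  rw [hφ.gram_mulVec, inner_synthesis_left]

lemma inner_synthesis_feature (hφ : IsFeatureMap k φ) (a : Fin n → X) (w : Fin n → ℝ) (z : X) :
    inner ℝ (synthesis φ a w) (φ z) = w ⬝ᵥ kvec k a z := by
  rw [inner_synthesis_left]
  exact congrArg _ (funext fun i => (hφ (a i) z).symm)

lemma ridgeCoef_eq_iff (hφ : IsFeatureMap k φ) (hs : 0 < s) (a : Fin n → X) {y w : Fin n → ℝ} :
    ridgeCoef k s a y = w ↔ gram k a *ᵥ w + s ^ 2 • w = y := by
  have hw : gram k a *ᵥ w + s ^ 2 • w = regGram k s a *ᵥ w := by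
    rw [regGram, Matrix.add_mulVec, Matrix.smul_mulVec, Matrix.one_mulVec]
  have hu := hφ.isUnit_det_regGram hs a
  rw [hw, ridgeCoef]
  constructor
  · rintro rfl
    rw [Matrix.mulVec_mulVec, Matrix.mul_nonsing_inv _ hu, Matrix.one_mulVec]
  · rintro rfl
    rw [Matrix.mulVec_mulVec, Matrix.nonsing_inv_mul _ hu, Matrix.one_mulVec]

lemma gram_mulVec_ridgeCoef (hφ : IsFeatureMap k φ) (hs : 0 < s) (a : Fin n → X)
    (y : Fin n → ℝ) :
    gram k a *ᵥ ridgeCoef k s a y = y - s ^ 2 • ridgeCoef k s a y :=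
  eq_sub_of_add_eq ((hφ.ridgeCoef_eq_iff hs a).1 rfl)

lemma dotProduct_ridgeCoef_comm (hφ : IsFeatureMap k φ) (hs : 0 < s) (a : Fin n → X)
    (u v : Fin n → ℝ) : u ⬝ᵥ ridgeCoef k s a v = v ⬝ᵥ ridgeCoef k s a u := by
  have hsymm : ((regGram k s a)⁻¹)ᵀ = (regGram k s a)⁻¹ := (hφ.posDef_regGram hs a).isHermitian.inv
  rw [ridgeCoef, ridgeCoef, Matrix.dotProduct_mulVec, dotProduct_comm, ← Matrix.mulVec_transpose,
    hsymm]

lemma selfNormSq_eq_inner (hφ : IsFeatureMap k φ) (a : Fin n → X) (e : Fin n → ℝ) :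
    selfNormSq k s a e = inner ℝ (synthesis φ a e) (synthesis φ a (ridgeCoef k s a e)) :=
  hφ.dotProduct_gram_mulVec a _ _

lemma selfNormSq_eq_sub (hφ : IsFeatureMap k φ) (hs : 0 < s) (a : Fin n → X) (e : Fin n → ℝ) :
    selfNormSq k s a e = e ⬝ᵥ e - s ^ 2 * (e ⬝ᵥ ridgeCoef k s a e) := by
  rw [selfNormSq, hφ.gram_mulVec_ridgeCoef hs, dotProduct_sub, dotProduct_smul, smul_eq_mul]

lemma synthesis_eq_ridge_add (hφ : IsFeatureMap k φ) (hs : 0 < s) (a : Fin n → X)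
    (e : Fin n → ℝ) :
    synthesis φ a e = s ^ 2 • synthesis φ a (ridgeCoef k s a e)
      + synthesis φ a (gram k a *ᵥ ridgeCoef k s a e) := by
  rw [hφ.gram_mulVec_ridgeCoef hs, map_sub, map_smul, add_sub_cancel]

lemma selfNormSq_eq_add (hφ : IsFeatureMap k φ) (hs : 0 < s) (a : Fin n → X) (e : Fin n → ℝ) :
    selfNormSq k s a e = s ^ 2 * ‖synthesis φ a (ridgeCoef k s a e)‖ ^ 2
      + (gram k a *ᵥ ridgeCoef k s a e) ⬝ᵥ (gram k a *ᵥ ridgeCoef k s a e) := by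
  rw [hφ.selfNormSq_eq_inner, hφ.synthesis_eq_ridge_add hs a e, inner_add_left,
    real_inner_smul_left, real_inner_self_eq_norm_sq, ← hφ.dotProduct_gram_mulVec]

lemma sq_mul_norm_sq_le_selfNormSq (hφ : IsFeatureMap k φ) (hs : 0 < s) (a : Fin n → X)
    (e : Fin n → ℝ) :
    s ^ 2 * ‖synthesis φ a (ridgeCoef k s a e)‖ ^ 2 ≤ selfNormSq k s a e := by
  rw [hφ.selfNormSq_eq_add hs]
  exact le_add_of_nonneg_right (Finset.sum_nonneg fun i _ => mul_self_nonneg _)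

lemma selfNormSq_nonneg (hφ : IsFeatureMap k φ) (hs : 0 < s) (a : Fin n → X) (e : Fin n → ℝ) :
    0 ≤ selfNormSq k s a e :=
  (by positivity : (0 : ℝ) ≤ _).trans (hφ.sq_mul_norm_sq_le_selfNormSq hs a e)

end IsFeatureMap

lemma sq_inner_add_dotProduct_le {ι : Type*} [Fintype ι] {c : ℝ} (hc : 0 ≤ c) (u v : H)
    (p q : ι → ℝ) :
    (c * inner ℝ u v + p ⬝ᵥ q) ^ 2 ≤ (c * ‖u‖ ^ 2 + p ⬝ᵥ p) * (c * ‖v‖ ^ 2 + q ⬝ᵥ q) := by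
  have h := real_inner_mul_inner_self_le (WithLp.toLp 2 (√c • u, WithLp.toLp 2 p))
    (WithLp.toLp 2 (√c • v, WithLp.toLp 2 q))
  simpa only [WithLp.prod_inner_apply, real_inner_smul_left, real_inner_smul_right, ← mul_assoc,
    Real.mul_self_sqrt hc, real_inner_self_eq_norm_sq, norm_smul, mul_pow,
    Real.norm_of_nonneg (Real.sqrt_nonneg c), Real.sq_sqrt hc, EuclideanSpace.inner_toLp_toLp,
    star_trivial, dotProduct_comm q p, ← pow_two] using h

namespace IsFeatureMap

/-- The Cauchy–Schwarz inequality for the dual pair of norms of `Φ Φᵀ + s²` and its inverse. -/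
lemma sq_inner_synthesis_le (hφ : IsFeatureMap k φ) (hs : 0 < s) (a : Fin n → X) (e : Fin n → ℝ)
    (h : H) :
    inner ℝ (synthesis φ a e) h ^ 2
      ≤ selfNormSq k s a e * (s ^ 2 * ‖h‖ ^ 2 + ∑ i, inner ℝ (φ (a i)) h ^ 2) := by
  have hcs := sq_inner_add_dotProduct_le (sq_nonneg s) (synthesis φ a (ridgeCoef k s a e)) h
    (gram k a *ᵥ ridgeCoef k s a e) fun i => inner ℝ (φ (a i)) h
  rw [← hφ.selfNormSq_eq_add hs, ← real_inner_smul_left, ← inner_synthesis_left, ← inner_add_left,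
    ← hφ.synthesis_eq_ridge_add hs] at hcs
  simpa only [dotProduct, ← pow_two] using hcs

lemma norm_synthesis_sq_le (hφ : IsFeatureMap k φ) (hs : 0 < s) (a : Fin n → X)
    (e : Fin n → ℝ) :
    ‖synthesis φ a e‖ ^ 2 ≤ selfNormSq k s a e * (s ^ 2 + (gram k a).trace) := by
  set v := synthesis φ a e
  have hsum : ∑ i, inner ℝ (φ (a i)) v ^ 2 ≤ (gram k a).trace * ‖v‖ ^ 2 := by
    rw [trace_gram, Finset.sum_mul]
    refine Finset.sum_le_sum fun i _ => ?_
    rw [hφ, real_inner_self_eq_norm_sq, ← mul_pow]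
    exact sq_le_sq' (neg_le_of_abs_le (abs_real_inner_le_norm _ _)) (real_inner_le_norm _ _)
  have htrace : 0 ≤ (gram k a).trace := (hφ.posSemidef_gram a).trace_nonneg
  have hZ := hφ.selfNormSq_nonneg hs a e
  rcases (sq_nonneg ‖v‖).eq_or_lt with hv | hv
  · rw [← hv]
    positivity
  · refine le_of_mul_le_mul_right ?_ hv
    calc ‖v‖ ^ 2 * ‖v‖ ^ 2 = inner ℝ v v ^ 2 := by rw [real_inner_self_eq_norm_sq, sq (‖v‖ ^ 2)]
      _ ≤ selfNormSq k s a e * (s ^ 2 * ‖v‖ ^ 2 + ∑ i, inner ℝ (φ (a i)) v ^ 2) :=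
        hφ.sq_inner_synthesis_le hs a e v
      _ ≤ selfNormSq k s a e * (s ^ 2 * ‖v‖ ^ 2 + (gram k a).trace * ‖v‖ ^ 2) := by gcongr
      _ = selfNormSq k s a e * (s ^ 2 + (gram k a).trace) * ‖v‖ ^ 2 := by ring

lemma sq_mul_selfNormSq_le (hφ : IsFeatureMap k φ) (hs : 0 < s) (a : Fin n → X)
    (e : Fin n → ℝ) : s ^ 2 * selfNormSq k s a e ≤ ‖synthesis φ a e‖ ^ 2 := by
  have hlow := hφ.sq_mul_norm_sq_le_selfNormSq hs a e
  have hup : selfNormSq k s a e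
      ≤ ‖synthesis φ a e‖ * ‖synthesis φ a (ridgeCoef k s a e)‖ := by
    rw [hφ.selfNormSq_eq_inner]
    exact real_inner_le_norm _ _
  nlinarith [sq_nonneg (‖synthesis φ a e‖ - s ^ 2 * ‖synthesis φ a (ridgeCoef k s a e)‖),
    mul_le_mul_of_nonneg_left hup (sq_nonneg s)]

lemma selfNormSq_le_of_trace_le (hφ : IsFeatureMap k φ) {s' : ℝ} (hs : 0 < s) (hs' : 0 < s')
    (a : Fin n → X) (e : Fin n → ℝ) :
    s ^ 2 * selfNormSq k s a e ≤ selfNormSq k s' a e * (s' ^ 2 + (gram k a).trace) :=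
  (hφ.sq_mul_selfNormSq_le hs a e).trans (hφ.norm_synthesis_sq_le hs' a e)

/-- The residual `φ z - Φ α`, where `α = (K + s² I)⁻¹ k(z)`, has the inner products `s² αᵢ` with
the features, hence its squared norm for `Φ Φᵀ + s²` is `s²` times the posterior variance. -/
lemma inner_feature_residual (hφ : IsFeatureMap k φ) (hs : 0 < s) (a : Fin n → X) (z : X)
    (i : Fin n) :
    inner ℝ (φ (a i)) (φ z - synthesis φ a (ridgeCoef k s a (kvec k a z)))
      = s ^ 2 * ridgeCoef k s a (kvec k a z) i := by
  have h := congrFun (hφ.gram_mulVec_ridgeCoef hs a (kvec k a z)) i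
  simp only [hφ.gram_mulVec, Pi.sub_apply, Pi.smul_apply, smul_eq_mul] at h
  rw [inner_sub_right, h, ← hφ, kvec, sub_sub_cancel]

lemma sq_mul_postVar_eq (hφ : IsFeatureMap k φ) (hs : 0 < s) (a : Fin n → X) (z : X) :
    s ^ 2 * postVar k s a z
      = s ^ 2 * ‖φ z - synthesis φ a (ridgeCoef k s a (kvec k a z))‖ ^ 2
        + ∑ i, inner ℝ (φ (a i)) (φ z - synthesis φ a (ridgeCoef k s a (kvec k a z))) ^ 2 := by
  set α := ridgeCoef k s a (kvec k a z) with hα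
  have hnorm : ‖φ z - synthesis φ a α‖ ^ 2
      = k z z - α ⬝ᵥ kvec k a z - s ^ 2 * (α ⬝ᵥ α) := by
    rw [norm_sub_sq_real, real_inner_comm, hφ.inner_synthesis_feature,
      ← real_inner_self_eq_norm_sq, ← real_inner_self_eq_norm_sq (synthesis φ a α),
      ← hφ.dotProduct_gram_mulVec, hφ.gram_mulVec_ridgeCoef hs, ← hφ, dotProduct_sub,
      dotProduct_smul, smul_eq_mul]
    ring
  have hsum : ∑ i, (s ^ 2 * α i) ^ 2 = s ^ 4 * (α ⬝ᵥ α) := by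
    rw [dotProduct, Finset.mul_sum]
    exact Finset.sum_congr rfl fun i _ => by ring
  have hvar : postVar k s a z = k z z - α ⬝ᵥ kvec k a z := by
    rw [dotProduct_comm]
    rfl
  simp only [hα ▸ hφ.inner_feature_residual hs a z, hnorm, hsum, hvar]
  ring

lemma postVar_nonneg (hφ : IsFeatureMap k φ) (hs : 0 < s) (a : Fin n → X) (z : X) :
    0 ≤ postVar k s a z :=
  nonneg_of_mul_nonneg_right ((hφ.sq_mul_postVar_eq hs a z).ge.trans' (by positivity))
    (pow_pos hs 2)

lemma norm_residual_le_postStd (hφ : IsFeatureMap k φ) (hs : 0 < s) (a : Fin n → X) (z : X) :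
    ‖φ z - synthesis φ a (ridgeCoef k s a (kvec k a z))‖ ≤ postStd k s a z := by
  refine Real.le_sqrt_of_sq_le (le_of_mul_le_mul_left ?_ (pow_pos hs 2))
  rw [hφ.sq_mul_postVar_eq hs]
  exact le_add_of_nonneg_right (by positivity)

lemma abs_kvec_dotProduct_ridgeCoef_le (hφ : IsFeatureMap k φ) (hs : 0 < s) (a : Fin n → X)
    (e : Fin n → ℝ) (z : X) :
    |kvec k a z ⬝ᵥ ridgeCoef k s a e| ≤ √(selfNormSq k s a e) / s * postStd k s a z := by
  set α := ridgeCoef k s a (kvec k a z)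
  have hinner : inner ℝ (synthesis φ a e) (φ z - synthesis φ a α) = s ^ 2 * (e ⬝ᵥ α) := by
    rw [inner_synthesis_left, ← smul_eq_mul, ← dotProduct_smul]
    exact congrArg _ (funext fun i => hφ.inner_feature_residual hs a z i)
  have hcs := hφ.sq_inner_synthesis_le hs a e (φ z - synthesis φ a α)
  rw [hinner, ← hφ.sq_mul_postVar_eq hs] at hcs
  rw [hφ.dotProduct_ridgeCoef_comm hs, postStd, div_mul_eq_mul_div, le_div_iff₀ hs,
    ← Real.sqrt_mul (hφ.selfNormSq_nonneg hs a e)]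
  refine Real.le_sqrt_of_sq_le (le_of_mul_le_mul_left ?_ (pow_pos hs 2))
  rw [mul_pow, sq_abs]
  linarith

lemma abs_sub_postMean_le (hφ : IsFeatureMap k φ) (hs : 0 < s) (a : Fin n → X) (e : Fin n → ℝ)
    (g : H) (z : X) :
    |inner ℝ g (φ z) - postMean k s a (fun i => inner ℝ g (φ (a i)) + e i) z|
      ≤ (‖g‖ + √(selfNormSq k s a e) / s) * postStd k s a z := by
  set α := ridgeCoef k s a (kvec k a z)
  have hmean : postMean k s a (fun i => inner ℝ g (φ (a i)) + e i) z
      = inner ℝ g (synthesis φ a α) + kvec k a z ⬝ᵥ ridgeCoef k s a e := by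
    change kvec k a z ⬝ᵥ ridgeCoef k s a ((fun i => inner ℝ g (φ (a i))) + e) = _
    rw [hφ.dotProduct_ridgeCoef_comm hs, add_dotProduct, hφ.dotProduct_ridgeCoef_comm hs a e,
      real_inner_comm, inner_synthesis_left, dotProduct_comm]
    simp only [real_inner_comm, α]
  have hbias : |inner ℝ g (φ z - synthesis φ a α)| ≤ ‖g‖ * postStd k s a z :=
    (abs_real_inner_le_norm _ _).trans
      (mul_le_mul_of_nonneg_left (hφ.norm_residual_le_postStd hs a z) (norm_nonneg g))
  rw [hmean, sub_add_eq_sub_sub, ← inner_sub_right, add_mul]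
  exact (abs_sub _ _).trans (add_le_add hbias (hφ.abs_kvec_dotProduct_ridgeCoef_le hs a e z))

end IsFeatureMap

end RidgeRegression

section Recursion

variable {X H : Type*} [NormedAddCommGroup H] [InnerProductSpace ℝ H]
  {k : X → X → ℝ} {φ : X → H} {s : ℝ} {n : ℕ}

lemma gainDet_eq (hs : 0 < s) (a : Fin n → X) :
    gainDet k s a = (s ^ 2)⁻¹ ^ n * (regGram k s a).det := by
  have h : (1 + (s ^ 2)⁻¹ • gram k a : Matrix (Fin n) (Fin n) ℝ) = (s ^ 2)⁻¹ • regGram k s a := by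
    rw [regGram, smul_add, smul_smul, inv_mul_cancel₀ (pow_pos hs 2).ne', one_smul, add_comm]
  rw [gainDet, h, Matrix.det_smul, Fintype.card_fin]

lemma gram_mulVec_snoc_castSucc (a : Fin (n + 1) → X) (w : Fin n → ℝ) (c : ℝ) (i : Fin n) :
    (gram k a *ᵥ Fin.snoc (α := fun _ => ℝ) w c) i.castSucc
      = (gram k (Fin.init a) *ᵥ w) i + c * kvec k (Fin.init a) (a (Fin.last n)) i := by
  simp only [Matrix.mulVec, dotProduct, Fin.sum_univ_castSucc, Fin.snoc_castSucc, Fin.snoc_last,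
    mul_comm c]
  rfl

namespace IsFeatureMap

lemma gram_mulVec_snoc_last (hφ : IsFeatureMap k φ) (a : Fin (n + 1) → X) (w : Fin n → ℝ)
    (c : ℝ) :
    (gram k a *ᵥ Fin.snoc (α := fun _ => ℝ) w c) (Fin.last n)
      = kvec k (Fin.init a) (a (Fin.last n)) ⬝ᵥ w + c * k (a (Fin.last n)) (a (Fin.last n)) := by
  simp only [Matrix.mulVec, dotProduct, Fin.sum_univ_castSucc, Fin.snoc_castSucc, Fin.snoc_last,
    mul_comm c, gram, Matrix.of_apply, kvec, Fin.init, hφ.comm (a (Fin.last n))]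

lemma ridgeCoef_succ (hφ : IsFeatureMap k φ) (hs : 0 < s) (a : Fin (n + 1) → X)
    (e : Fin (n + 1) → ℝ) {c : ℝ}
    (hc : c * (s ^ 2 + postVar k s (Fin.init a) (a (Fin.last n)))
      = e (Fin.last n) - postMean k s (Fin.init a) (Fin.init e) (a (Fin.last n))) :
    ridgeCoef k s a e
      = Fin.snoc (α := fun _ => ℝ) (ridgeCoef k s (Fin.init a) (Fin.init e)
          - c • ridgeCoef k s (Fin.init a) (kvec k (Fin.init a) (a (Fin.last n)))) c := by
  rw [hφ.ridgeCoef_eq_iff hs]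
  funext i
  refine Fin.lastCases ?_ (fun i => ?_) i
  · rw [Pi.add_apply, hφ.gram_mulVec_snoc_last, Pi.smul_apply, Fin.snoc_last, dotProduct_sub,
      dotProduct_smul, smul_eq_mul, smul_eq_mul]
    unfold postVar postMean at hc
    unfold ridgeCoef
    linarith
  · rw [Pi.add_apply, gram_mulVec_snoc_castSucc, Pi.smul_apply, Fin.snoc_castSucc,
      Matrix.mulVec_sub, Matrix.mulVec_smul, hφ.gram_mulVec_ridgeCoef hs,
      hφ.gram_mulVec_ridgeCoef hs]
    simp only [Pi.sub_apply, Pi.smul_apply, smul_eq_mul, Fin.init]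
    ring

lemma sq_add_postVar_pos (hφ : IsFeatureMap k φ) (hs : 0 < s) (a : Fin n → X) (z : X) :
    0 < s ^ 2 + postVar k s a z :=
  add_pos_of_pos_of_nonneg (pow_pos hs 2) (hφ.postVar_nonneg hs a z)

lemma selfNormSq_succ (hφ : IsFeatureMap k φ) (hs : 0 < s) (a : Fin (n + 1) → X)
    (e : Fin (n + 1) → ℝ) :
    selfNormSq k s a e = selfNormSq k s (Fin.init a) (Fin.init e) + (e (Fin.last n) ^ 2
      - (e (Fin.last n) - postMean k s (Fin.init a) (Fin.init e) (a (Fin.last n))) ^ 2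
        / (1 + postVar k s (Fin.init a) (a (Fin.last n)) / s ^ 2)) := by
  have hpos := hφ.sq_add_postVar_pos hs (Fin.init a) (a (Fin.last n))
  have hmean : Fin.init e ⬝ᵥ ridgeCoef k s (Fin.init a) (kvec k (Fin.init a) (a (Fin.last n)))
      = postMean k s (Fin.init a) (Fin.init e) (a (Fin.last n)) :=
    hφ.dotProduct_ridgeCoef_comm hs _ _ _
  have hdot (u : Fin n → ℝ) (c : ℝ) :
      e ⬝ᵥ Fin.snoc (α := fun _ => ℝ) u c = Fin.init e ⬝ᵥ u + e (Fin.last n) * c := by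
    simp [dotProduct, Fin.sum_univ_castSucc, Fin.init]
  rw [hφ.selfNormSq_eq_sub hs, hφ.selfNormSq_eq_sub hs,
    hφ.ridgeCoef_succ hs a e (div_mul_cancel₀ _ hpos.ne'), hdot, dotProduct_sub, dotProduct_smul,
    hmean, smul_eq_mul, one_add_div (pow_pos hs 2).ne', div_div_eq_mul_div]
  have hee : e ⬝ᵥ e = Fin.init e ⬝ᵥ Fin.init e + e (Fin.last n) ^ 2 := by
    simp [dotProduct, Fin.sum_univ_castSucc, Fin.init, sq]
  rw [hee]
  field_simp
  ring

/-- By Cramer's rule the last diagonal entry of `(K + s² I)⁻¹` is a quotient of determinants; it is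
also the last ridge coefficient of the unit vector, that is `(s² + postVar)⁻¹`. -/
lemma det_regGram_succ (hφ : IsFeatureMap k φ) (hs : 0 < s) (a : Fin (n + 1) → X) :
    (regGram k s a).det = (regGram k s (Fin.init a)).det
      * (s ^ 2 + postVar k s (Fin.init a) (a (Fin.last n))) := by
  have hpos := hφ.sq_add_postVar_pos hs (Fin.init a) (a (Fin.last n))
  have hdet := (hφ.posDef_regGram hs a).det_pos.ne'
  have hinit : Fin.init (Pi.single (Fin.last n) 1 : Fin (n + 1) → ℝ) = 0 :=
    funext fun i => Pi.single_eq_of_ne (Fin.castSucc_lt_last i).ne 1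
  have hsub : (regGram k s a).submatrix Fin.castSucc Fin.castSucc = regGram k s (Fin.init a) := by
    ext i j
    simp [regGram, gram, Fin.init, Matrix.one_apply]
  have hridge : (regGram k s a)⁻¹ (Fin.last n) (Fin.last n)
      = (s ^ 2 + postVar k s (Fin.init a) (a (Fin.last n)))⁻¹ := by
    have h := hφ.ridgeCoef_succ hs a (Pi.single (Fin.last n) 1)
      (c := (s ^ 2 + postVar k s (Fin.init a) (a (Fin.last n)))⁻¹) (by
        simp [hinit, postMean, inv_mul_cancel₀ hpos.ne'])
    simpa [ridgeCoef] using congrFun h (Fin.last n)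
  have hcramer : (regGram k s a)⁻¹ (Fin.last n) (Fin.last n)
      = (regGram k s a).det⁻¹ * (regGram k s (Fin.init a)).det := by
    rw [Matrix.inv_def, Matrix.smul_apply, Matrix.adjugate_fin_succ_eq_det_submatrix,
      Fin.succAbove_last, hsub, Ring.inverse_eq_inv', Even.neg_one_pow ⟨_, rfl⟩, one_mul,
      smul_eq_mul]
  rw [hcramer] at hridge
  field_simp at hridge
  linarith

lemma gainDet_succ (hφ : IsFeatureMap k φ) (hs : 0 < s) (a : Fin (n + 1) → X) :
    gainDet k s a = gainDet k s (Fin.init a)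
      * (1 + postVar k s (Fin.init a) (a (Fin.last n)) / s ^ 2) := by
  rw [gainDet_eq hs, gainDet_eq hs, hφ.det_regGram_succ hs, pow_succ]
  field_simp

lemma one_add_trace_le_gainDet (hφ : IsFeatureMap k φ) (s : ℝ) (a : Fin n → X) :
    1 + (gram k a).trace / s ^ 2 ≤ gainDet k s a := by
  rw [div_eq_inv_mul, ← smul_eq_mul, ← Matrix.trace_smul]
  exact one_add_trace_le_det_one_add (hφ.posSemidef_smul_gram s a)

lemma one_le_gainDet (hφ : IsFeatureMap k φ) (s : ℝ) (a : Fin n → X) : 1 ≤ gainDet k s a :=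
  (le_add_of_nonneg_right (div_nonneg (hφ.posSemidef_gram a).trace_nonneg (sq_nonneg s))).trans
    (hφ.one_add_trace_le_gainDet s a)

lemma log_gainDet_nonneg (hφ : IsFeatureMap k φ) (s : ℝ) (a : Fin n → X) :
    0 ≤ Real.log (gainDet k s a) :=
  Real.log_nonneg (hφ.one_le_gainDet s a)

lemma log_gainDet_le (hφ : IsFeatureMap k φ) (s : ℝ) (a : Fin n → X) :
    Real.log (gainDet k s a) ≤ (gram k a).trace / s ^ 2 := by
  rw [Real.log_le_iff_le_exp (one_pos.trans_le (hφ.one_le_gainDet s a)), div_eq_inv_mul,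
    ← smul_eq_mul, ← Matrix.trace_smul]
  exact det_one_add_le_exp_trace (hφ.posSemidef_smul_gram s a)

end IsFeatureMap

end Recursion

section InfoGain

variable {X H : Type*} [NormedAddCommGroup H] [InnerProductSpace ℝ H]
  {k : X → X → ℝ} {φ : X → H} {s : ℝ} {n : ℕ}

namespace IsFeatureMap

lemma bddAbove_half_log_gainDet (hφ : IsFeatureMap k φ)
    (hk : BddAbove (Set.range fun z => k z z)) (s : ℝ) (n : ℕ) :
    BddAbove (Set.range fun a : Fin n → X => 1 / 2 * Real.log (gainDet k s a)) := by
  obtain ⟨C, hC⟩ := hk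
  refine ⟨1 / 2 * (n * C / s ^ 2), Set.forall_mem_range.2 fun a => ?_⟩
  have htrace : (gram k a).trace ≤ n * C := by
    rw [trace_gram, ← nsmul_eq_mul]
    simpa using Finset.sum_le_card_nsmul Finset.univ _ C fun i _ =>
      hC (Set.mem_range_self (a i))
  have hlog := hφ.log_gainDet_le s a
  gcongr
  exact hlog.trans (by gcongr)

lemma half_log_gainDet_le_infoGain (hφ : IsFeatureMap k φ)
    (hk : BddAbove (Set.range fun z => k z z)) (s : ℝ) (a : Fin n → X) :
    1 / 2 * Real.log (gainDet k s a) ≤ infoGain k s n :=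
  le_ciSup (hφ.bddAbove_half_log_gainDet hk s n) a

lemma infoGain_nonneg (hφ : IsFeatureMap k φ) (s : ℝ) (n : ℕ) : 0 ≤ infoGain k s n :=
  Real.iSup_nonneg fun a => mul_nonneg (by norm_num) (hφ.log_gainDet_nonneg s a)

lemma infoGain_le_succ [Nonempty X] (hφ : IsFeatureMap k φ)
    (hk : BddAbove (Set.range fun z => k z z)) (hs : 0 < s) (n : ℕ) :
    infoGain k s n ≤ infoGain k s (n + 1) := by
  obtain ⟨z⟩ := ‹Nonempty X›
  refine Real.iSup_le (fun a => ?_) (hφ.infoGain_nonneg s _)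
  refine le_trans ?_ (hφ.half_log_gainDet_le_infoGain hk s (Fin.snoc (α := fun _ => X) a z))
  have hvar := hφ.postVar_nonneg hs a z
  rw [hφ.gainDet_succ hs, Fin.init_snoc, Fin.snoc_last]
  have hpos := one_pos.trans_le (hφ.one_le_gainDet s a)
  change 1 / 2 * Real.log (gainDet k s a) ≤ _
  gcongr
  exact le_mul_of_one_le_right hpos.le (le_add_of_nonneg_right (by positivity))

/-- A small information gain linearises: `tr K / s² ≤ det (I + s⁻² K) - 1 ≤ exp (2 γ) - 1 ≤ 4 γ`. -/
lemma trace_le_of_infoGain_le (hφ : IsFeatureMap k φ) (hk : BddAbove (Set.range fun z => k z z))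
    (hs : 0 < s) (hγ : infoGain k s n ≤ 1 / 2) (a : Fin n → X) :
    (gram k a).trace ≤ 4 * infoGain k s n * s ^ 2 := by
  have hγ0 := hφ.infoGain_nonneg s n
  rw [← div_le_iff₀ (pow_pos hs 2)]
  have hdet : gainDet k s a ≤ Real.exp (2 * infoGain k s n) := by
    rw [← Real.log_le_iff_le_exp (one_pos.trans_le (hφ.one_le_gainDet s a))]
    linarith [hφ.half_log_gainDet_le_infoGain hk s a]
  have hexp : Real.exp (2 * infoGain k s n) - 1 ≤ 2 * (2 * infoGain k s n) := by
    have h := Real.abs_exp_sub_one_le (x := 2 * infoGain k s n)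
      (abs_le.2 ⟨by linarith, by linarith⟩)
    rw [abs_of_nonneg (by positivity : (0 : ℝ) ≤ 2 * infoGain k s n)] at h
    exact (le_abs_self _).trans h
  linarith [hφ.one_add_trace_le_gainDet s a]

end IsFeatureMap

end InfoGain

section Mixture

open scoped ENNReal NNReal

lemma lintegral_exp_linear_sub_quadratic_gaussianReal (p : ℝ) {q : ℝ} (hq : 0 ≤ q) :
    ∫⁻ g, ENNReal.ofReal (Real.exp (p * g - q * g ^ 2 / 2)) ∂gaussianReal 0 1
      = ENNReal.ofReal (Real.exp ((p ^ 2 / (1 + q) - Real.log (1 + q)) / 2)) := by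
  have h1q : 0 < 1 + q := by linarith
  let τ : ℝ≥0 := ⟨(1 + q)⁻¹, by positivity⟩
  have hτ : τ ≠ 0 := fun h => (inv_pos.2 h1q).ne' (congrArg NNReal.toReal h)
  have hdensity (g : ℝ) : gaussianPDFReal 0 1 g * Real.exp (p * g - q * g ^ 2 / 2)
      = Real.exp ((p ^ 2 / (1 + q) - Real.log (1 + q)) / 2)
        * gaussianPDFReal (p / (1 + q)) τ g := by
    have hsqrt : √(2 * Real.pi * τ) = √(2 * Real.pi) * (√(1 + q))⁻¹ := by
      rw [← Real.sqrt_inv, ← Real.sqrt_mul (by positivity)]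
      rfl
    have hlog : Real.exp ((p ^ 2 / (1 + q) - Real.log (1 + q)) / 2)
        = Real.exp (p ^ 2 / (1 + q) / 2) * (√(1 + q))⁻¹ := by
      rw [sub_div, Real.exp_sub, ← Real.log_sqrt h1q.le, Real.exp_log (Real.sqrt_pos.2 h1q),
        div_eq_mul_inv]
    have hsquare : -(g - 0) ^ 2 / (2 * 1) + (p * g - q * g ^ 2 / 2)
        = p ^ 2 / (1 + q) / 2 + -(g - p / (1 + q)) ^ 2 / (2 * τ) := by
      change _ = _ + -(g - p / (1 + q)) ^ 2 / (2 * (1 + q)⁻¹)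
      field_simp
      ring
    have hpos : √(1 + q) ≠ 0 := (Real.sqrt_pos.2 h1q).ne'
    rw [gaussianPDFReal, gaussianPDFReal, NNReal.coe_one, mul_assoc, ← Real.exp_add, hsquare,
      Real.exp_add, hlog, hsqrt, mul_one]
    field_simp
  rw [gaussianReal_of_var_ne_zero 0 one_ne_zero,
    lintegral_withDensity_eq_lintegral_mul _ (measurable_gaussianPDF 0 1) (by fun_prop)]
  simp only [Pi.mul_apply, gaussianPDF, ← ENNReal.ofReal_mul (gaussianPDFReal_nonneg 0 1 _),
    hdensity, ENNReal.ofReal_mul (Real.exp_pos _).le]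
  rw [lintegral_const_mul _ (measurable_gaussianPDFReal _ _).ennreal_ofReal]
  exact (congrArg _ (lintegral_gaussianPDF_eq_one _ hτ)).trans (mul_one _)

/-- The average of the sub-Gaussian factors `exp (λ x - c λ² / 2)` over a Gaussian `λ` with mean
`m / c` and variance `v / c`, in closed form. -/
noncomputable def mixtureFactor (c m v x : ℝ) : ℝ :=
  Real.exp (((x ^ 2 - (x - m) ^ 2 / (1 + v)) / c - Real.log (1 + v)) / 2)

lemma ofReal_mixtureFactor {c v : ℝ} (hc : 0 < c) (hv : 0 ≤ v) (m x : ℝ) :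
    ENNReal.ofReal (mixtureFactor c m v x)
      = ∫⁻ g, ENNReal.ofReal (Real.exp ((m + √(c * v) * g) / c * x
          - c * ((m + √(c * v) * g) / c) ^ 2 / 2)) ∂gaussianReal 0 1 := by
  have hsq : √(c * v) ^ 2 = c * v := Real.sq_sqrt (mul_nonneg hc.le hv)
  have hexp (g : ℝ) : (m + √(c * v) * g) / c * x - c * ((m + √(c * v) * g) / c) ^ 2 / 2
      = (2 * m * x - m ^ 2) / (2 * c) + (√(c * v) / c * (x - m) * g - v * g ^ 2 / 2) := by
    field_simp
    linear_combination (-g ^ 2) * hsq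
  simp only [hexp, Real.exp_add, ENNReal.ofReal_mul (Real.exp_pos _).le]
  rw [lintegral_const_mul _ (by fun_prop), lintegral_exp_linear_sub_quadratic_gaussianReal _ hv,
    ← ENNReal.ofReal_mul (Real.exp_pos _).le, ← Real.exp_add, mixtureFactor, mul_pow, div_pow, hsq]
  congr 2
  field_simp
  ring

lemma measurable_mixtureFactor {α : Type*} [MeasurableSpace α] (c : ℝ) {m v x : α → ℝ}
    (hm : Measurable m) (hv : Measurable v) (hx : Measurable x) :
    Measurable fun a => mixtureFactor c (m a) (v a) (x a) := by
  unfold mixtureFactor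
  fun_prop

lemma lintegral_exp_mul_sub_le_one {Ω : Type*} [MeasurableSpace Ω] {μ : Measure Ω} {Y : Ω → ℝ}
    {c : ℝ≥0} (hY : HasSubgaussianMGF Y c μ) (t : ℝ) :
    ∫⁻ ω, ENNReal.ofReal (Real.exp (t * Y ω - c * t ^ 2 / 2)) ∂μ ≤ 1 := by
  simp only [Real.exp_sub, div_eq_mul_inv _ (Real.exp _),
    ENNReal.ofReal_mul (Real.exp_pos _).le]
  rw [lintegral_mul_const' _ _ ENNReal.ofReal_ne_top,
    ← ofReal_integral_eq_lintegral_ofReal (hY.integrable_exp_mul t)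
      (ae_of_all _ fun _ => (Real.exp_pos _).le),
    ← ENNReal.ofReal_mul' (by positivity), ENNReal.ofReal_le_one, ← div_eq_mul_inv]
  exact div_le_one_of_le₀ (hY.mgf_le t) (Real.exp_pos _).le

lemma lintegral_mixtureFactor_le_one {Ω : Type*} [MeasurableSpace Ω] {μ : Measure Ω} [SFinite μ]
    {Y : Ω → ℝ} {c : ℝ≥0} (hY : HasSubgaussianMGF Y c μ) (hc : c ≠ 0) (m : ℝ) {v : ℝ}
    (hv : 0 ≤ v) : ∫⁻ ω, ENNReal.ofReal (mixtureFactor c m v (Y ω)) ∂μ ≤ 1 := by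
  have hYm := hY.aemeasurable
  simp only [ofReal_mixtureFactor (NNReal.coe_pos.2 (pos_iff_ne_zero.2 hc)) hv]
  rw [lintegral_lintegral_swap (by fun_prop)]
  calc ∫⁻ g, ∫⁻ ω, _ ∂μ ∂gaussianReal 0 1 ≤ ∫⁻ _, 1 ∂gaussianReal 0 1 :=
        lintegral_mono fun g => lintegral_exp_mul_sub_le_one hY _
    _ = 1 := by simp

lemma lintegral_mul_mixtureFactor_compProd_le {α : Type*} [MeasurableSpace α] {ν : Measure α}
    [SFinite ν] {κ : Kernel α ℝ} [IsFiniteKernel κ] {c : ℝ≥0}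
    (hκ : Kernel.HasSubgaussianMGF id c κ ν) (hc : c ≠ 0) {A : α → ℝ≥0∞} (hA : Measurable A)
    {m v : α → ℝ} (hm : Measurable m) (hv : Measurable v) (hv0 : ∀ b, 0 ≤ v b) :
    ∫⁻ p, A p.1 * ENNReal.ofReal (mixtureFactor c (m p.1) (v p.1) p.2) ∂(ν ⊗ₘ κ)
      ≤ ∫⁻ b, A b ∂ν := by
  have hmeas : Measurable fun p : α × ℝ => ENNReal.ofReal (mixtureFactor c (m p.1) (v p.1) p.2) :=
    (measurable_mixtureFactor c (by fun_prop) (by fun_prop) measurable_snd).ennreal_ofReal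
  rw [Measure.lintegral_compProd
    (f := fun p => A p.1 * ENNReal.ofReal (mixtureFactor c (m p.1) (v p.1) p.2))
    ((hA.comp measurable_fst).mul hmeas)]
  refine lintegral_mono_ae ?_
  filter_upwards [hκ.ae_forall_integrable_exp_mul, hκ.mgf_le] with b hint hmgf
  have hsection : Measurable fun y => ENNReal.ofReal (mixtureFactor c (m b) (v b) y) :=
    (measurable_mixtureFactor c measurable_const measurable_const measurable_id).ennreal_ofReal
  have hY : HasSubgaussianMGF id c (κ b) := ⟨hint, hmgf⟩
  calc ∫⁻ y, A b * ENNReal.ofReal (mixtureFactor c (m b) (v b) y) ∂κ b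
      = A b * ∫⁻ y, ENNReal.ofReal (mixtureFactor c (m b) (v b) (id y)) ∂κ b :=
        lintegral_const_mul (A b) hsection
    _ ≤ A b := mul_le_of_le_one_right' (lintegral_mixtureFactor_le_one hY hc (m b) (hv0 b))

variable {Ω α : Type*} [MeasurableSpace Ω] [mα : MeasurableSpace α] {P : Measure Ω}
  [IsFiniteMeasure P] {W : Ω → α} {ξ : Ω → ℝ} {c : ℝ≥0}

lemma kernelHasSubgaussianMGF_condDistrib (hW : Measurable W) (hξ : Measurable ξ)
    (hint : ∀ t : ℝ, Integrable (fun ω => Real.exp (t * ξ ω)) P)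
    (hcond : ∀ t : ℝ, P[fun ω => Real.exp (t * ξ ω) | mα.comap W]
      ≤ᵐ[P] fun _ => Real.exp (c * t ^ 2 / 2)) :
    Kernel.HasSubgaussianMGF id c (condDistrib ξ W P) (P.map W) := by
  refine Kernel.HasSubgaussianMGF.of_rat (fun t => ?_) fun q => ?_
  · rw [condDistrib_comp_map hW.aemeasurable hξ.aemeasurable,
      integrable_map_measure (by fun_prop) hξ.aemeasurable]
    exact hint t
  · have hexp : StronglyMeasurable fun y : ℝ => Real.exp (q * y) := by fun_prop
    have hmgf : Measurable fun b => ∫ y, Real.exp (q * y) ∂condDistrib ξ W P b :=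
      (hexp.integral_kernel).measurable
    refine (ae_map_iff hW.aemeasurable (measurableSet_le hmgf measurable_const)).2 ?_
    filter_upwards [hcond q, condExp_ae_eq_integral_condDistrib hW hξ.aemeasurable hexp (hint q)]
      with ω hle heq
    exact heq.ge.trans hle

lemma lintegral_mul_mixtureFactor_comp_le (hW : Measurable W) (hξ : Measurable ξ)
    (hint : ∀ t : ℝ, Integrable (fun ω => Real.exp (t * ξ ω)) P)
    (hcond : ∀ t : ℝ, P[fun ω => Real.exp (t * ξ ω) | mα.comap W]
      ≤ᵐ[P] fun _ => Real.exp (c * t ^ 2 / 2)) (hc : c ≠ 0)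
    {A : α → ℝ≥0∞} (hA : Measurable A) {m v : α → ℝ} (hm : Measurable m)
    (hv : Measurable v) (hv0 : ∀ b, 0 ≤ v b) :
    ∫⁻ ω, A (W ω) * ENNReal.ofReal (mixtureFactor c (m (W ω)) (v (W ω)) (ξ ω)) ∂P
      ≤ ∫⁻ ω, A (W ω) ∂P := by
  have hmeas : Measurable fun p : α × ℝ =>
      A p.1 * ENNReal.ofReal (mixtureFactor c (m p.1) (v p.1) p.2) :=
    (hA.comp measurable_fst).mul
      (measurable_mixtureFactor c (by fun_prop) (by fun_prop) measurable_snd).ennreal_ofReal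
  have h := lintegral_mul_mixtureFactor_compProd_le
    (kernelHasSubgaussianMGF_condDistrib hW hξ hint hcond) hc hA hm hv hv0
  rwa [compProd_map_condDistrib hξ.aemeasurable, lintegral_map hmeas (hW.prodMk hξ),
    lintegral_map hA hW] at h

lemma lintegral_mul_mixtureFactor_le {Ω : Type*} {G mΩ : MeasurableSpace Ω} {P : Measure Ω}
    [IsFiniteMeasure P] {ξ : Ω → ℝ} (hG : G ≤ mΩ) (hξ : Measurable ξ)
    (hint : ∀ t : ℝ, Integrable (fun ω => Real.exp (t * ξ ω)) P)
    (hcond : ∀ t : ℝ, P[fun ω => Real.exp (t * ξ ω) | G]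
      ≤ᵐ[P] fun _ => Real.exp (c * t ^ 2 / 2)) (hc : c ≠ 0)
    {A : Ω → ℝ≥0∞} (hA : Measurable[G] A) {m v : Ω → ℝ} (hm : Measurable[G] m)
    (hv : Measurable[G] v) (hv0 : ∀ ω, 0 ≤ v ω) :
    ∫⁻ ω, A ω * ENNReal.ofReal (mixtureFactor c (m ω) (v ω) (ξ ω)) ∂P ≤ ∫⁻ ω, A ω ∂P :=
  lintegral_mul_mixtureFactor_comp_le (mα := G) (W := id) (measurable_id'' hG) hξ hint
    (by rwa [MeasurableSpace.comap_id]) hc hA hm hv hv0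

end Mixture

section Measurability

section Matrix

variable {α R ι : Type*} {mα : MeasurableSpace α} [MeasurableSpace R] [Fintype ι] [DecidableEq ι]
  {M : α → Matrix ι ι R}

lemma measurable_det [CommRing R] [MeasurableAdd₂ R] [MeasurableMul₂ R]
    (hM : ∀ i j, Measurable fun b => M b i j) : Measurable fun b => (M b).det := by
  simp only [Matrix.det_apply']
  fun_prop

lemma measurable_inv_apply [Field R] [MeasurableAdd₂ R] [MeasurableMul₂ R] [MeasurableInv R]
    (hM : ∀ i j, Measurable fun b => M b i j) (i j : ι) : Measurable fun b => (M b)⁻¹ i j := by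
  simp only [Matrix.inv_def, Ring.inverse_eq_inv', Matrix.smul_apply, smul_eq_mul,
    Matrix.adjugate_apply]
  refine (measurable_det hM).inv.mul (measurable_det fun p q => ?_)
  simp only [Matrix.updateRow_apply]
  split_ifs
  · exact measurable_const
  · exact hM p q

end Matrix

variable {α X : Type*} {mα : MeasurableSpace α} [MeasurableSpace X] {k : X → X → ℝ} {n : ℕ}
  {a : α → Fin n → X} {y : α → Fin n → ℝ} {z : α → X}

lemma measurable_gram_apply (hk : Measurable (Function.uncurry k)) (ha : Measurable a)
    (i j : Fin n) : Measurable fun b => gram k (a b) i j :=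
  hk.comp (by fun_prop : Measurable fun b => (a b i, a b j))

lemma measurable_kvec (hk : Measurable (Function.uncurry k)) (ha : Measurable a)
    (hz : Measurable z) : Measurable fun b => kvec k (a b) (z b) :=
  measurable_pi_lambda _ fun i => hk.comp (by fun_prop : Measurable fun b => (a b i, z b))

lemma measurable_regGram_apply (hk : Measurable (Function.uncurry k)) (s : ℝ) (ha : Measurable a)
    (i j : Fin n) : Measurable fun b => regGram k s (a b) i j :=
  (measurable_gram_apply hk ha i j).add_const ((s ^ 2 • (1 : Matrix (Fin n) (Fin n) ℝ)) i j)

lemma measurable_ridgeCoef (hk : Measurable (Function.uncurry k)) (s : ℝ) (ha : Measurable a)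
    (hy : Measurable y) : Measurable fun b => ridgeCoef k s (a b) (y b) :=
  measurable_pi_lambda _ fun i => Finset.measurable_fun_sum Finset.univ fun j _ =>
    (measurable_inv_apply (measurable_regGram_apply hk s ha) i j).mul (by fun_prop)

lemma measurable_postMean (hk : Measurable (Function.uncurry k)) (s : ℝ) (ha : Measurable a)
    (hy : Measurable y) (hz : Measurable z) :
    Measurable fun b => postMean k s (a b) (y b) (z b) := by
  have hkvec := measurable_kvec hk ha hz
  have hcoef := measurable_ridgeCoef hk s ha hy
  change Measurable fun b => kvec k (a b) (z b) ⬝ᵥ ridgeCoef k s (a b) (y b)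
  unfold dotProduct
  fun_prop

lemma measurable_postVar (hk : Measurable (Function.uncurry k)) (s : ℝ) (ha : Measurable a)
    (hz : Measurable z) : Measurable fun b => postVar k s (a b) (z b) :=
  (hk.comp (hz.prodMk hz)).sub (measurable_postMean hk s ha (measurable_kvec hk ha hz) hz)

lemma measurable_selfNormSq (hk : Measurable (Function.uncurry k)) (s : ℝ) (ha : Measurable a)
    (hy : Measurable y) : Measurable fun b => selfNormSq k s (a b) (y b) := by
  have hgram := measurable_gram_apply hk ha
  have hcoef := measurable_ridgeCoef hk s ha hy
  unfold selfNormSq Matrix.mulVec dotProduct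
  fun_prop

lemma measurable_gainDet (hk : Measurable (Function.uncurry k)) (s : ℝ) (ha : Measurable a) :
    Measurable fun b => gainDet k s (a b) :=
  measurable_det fun i j => ((measurable_gram_apply hk ha i j).const_mul (s ^ 2)⁻¹).const_add _

end Measurability

section Concentration

open scoped ENNReal NNReal

/-- The first `n` noise variables `ε_1, …, ε_n` along the outcome `ω`. -/
def noise {Ω : Type*} (ε : ℕ → Ω → ℝ) (n : ℕ) (ω : Ω) : Fin n → ℝ :=
  fun i => ε (i + 1) ω

/-- The exponential supermartingale of the method of mixtures for noise of proxy variance `c`. It is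
the product of the mixture factors of the first `n` rounds, see `mixtureProcess_succ`. -/
noncomputable def mixtureProcess {X Ω : Type*} (k : X → X → ℝ) (s c : ℝ) (x : ℕ → Ω → X)
    (ε : ℕ → Ω → ℝ) (n : ℕ) (ω : Ω) : ℝ :=
  Real.exp ((selfNormSq k s (queries x n ω) (noise ε n ω) / c
    - Real.log (gainDet k s (queries x n ω))) / 2)

section Supermartingale

variable {X H : Type*} [NormedAddCommGroup H] [InnerProductSpace ℝ H] {k : X → X → ℝ} {φ : X → H}
  {s : ℝ} {Ω : Type*}

lemma IsFeatureMap.mixtureProcess_succ (hφ : IsFeatureMap k φ) (hs : 0 < s) (c : ℝ)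
    (x : ℕ → Ω → X) (ε : ℕ → Ω → ℝ) (n : ℕ) (ω : Ω) :
    mixtureProcess k s c x ε (n + 1) ω = mixtureProcess k s c x ε n ω
      * mixtureFactor c (postMean k s (queries x n ω) (noise ε n ω) (x (n + 1) ω))
        (postVar k s (queries x n ω) (x (n + 1) ω) / s ^ 2) (ε (n + 1) ω) := by
  have hvar : 0 ≤ postVar k s (queries x n ω) (x (n + 1) ω) / s ^ 2 :=
    div_nonneg (hφ.postVar_nonneg hs _ _) (sq_nonneg s)
  have hZ := hφ.selfNormSq_succ hs (queries x (n + 1) ω) (noise ε (n + 1) ω)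
  have hD := hφ.gainDet_succ hs (queries x (n + 1) ω)
  change _ = selfNormSq k s (queries x n ω) (noise ε n ω) + (ε (n + 1) ω ^ 2
    - (ε (n + 1) ω - postMean k s (queries x n ω) (noise ε n ω) (x (n + 1) ω)) ^ 2
      / (1 + postVar k s (queries x n ω) (x (n + 1) ω) / s ^ 2)) at hZ
  change _ = gainDet k s (queries x n ω)
    * (1 + postVar k s (queries x n ω) (x (n + 1) ω) / s ^ 2) at hD
  rw [mixtureProcess, mixtureProcess, mixtureFactor, ← Real.exp_add, hZ, hD,
    Real.log_mul (one_pos.trans_le (hφ.one_le_gainDet s _)).ne' (by positivity)]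
  ring_nf

variable {mΩ : MeasurableSpace Ω} {ℱ : Filtration ℕ mΩ} {x : ℕ → Ω → X} {ε : ℕ → Ω → ℝ} {n : ℕ}

lemma measurable_queries [MeasurableSpace X]
    (hx : ∀ t ∈ Finset.Icc 1 n, Measurable[ℱ (t - 1)] (x t)) {m : ℕ} (hm : n ≤ m + 1) :
    Measurable[ℱ m] (queries x n) :=
  @measurable_pi_lambda _ _ _ (ℱ m) _ _ fun i =>
    (hx (i + 1) (Finset.mem_Icc.2 ⟨by omega, i.isLt⟩)).mono (ℱ.mono (by omega)) le_rfl

lemma measurable_noise (hε : ∀ t ∈ Finset.Icc 1 n, Measurable[ℱ t] (ε t)) :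
    Measurable[ℱ n] (noise ε n) :=
  @measurable_pi_lambda _ _ _ (ℱ n) _ _ fun i =>
    (hε (i + 1) (Finset.mem_Icc.2 ⟨by omega, i.isLt⟩)).mono (ℱ.mono i.isLt) le_rfl

lemma measurable_mixtureProcess [MeasurableSpace X] (hk : Measurable (Function.uncurry k))
    (s c : ℝ) (hx : ∀ t ∈ Finset.Icc 1 n, Measurable[ℱ (t - 1)] (x t))
    (hε : ∀ t ∈ Finset.Icc 1 n, Measurable[ℱ t] (ε t)) :
    Measurable[ℱ n] (mixtureProcess k s c x ε n) := by
  have hq := measurable_queries hx n.le_succ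
  have hZ := measurable_selfNormSq hk s hq (measurable_noise hε)
  have hD := measurable_gainDet hk s hq
  exact (((hZ.div_const c).sub hD.log).div_const 2).exp

end Supermartingale

lemma IsCondSubGaussianNoise.mono {Ω : Type*} {mΩ : MeasurableSpace Ω} {P : Measure Ω}
    {ℱ : Filtration ℕ mΩ} {R R' : ℝ} {ε : ℕ → Ω → ℝ} {T T' : ℕ}
    (hε : IsCondSubGaussianNoise P ℱ R ε T) (hR : |R| ≤ |R'|) (hT : T' ≤ T) :
    IsCondSubGaussianNoise P ℱ R' ε T' := by
  intro t ht
  obtain ⟨hmeas, hsub⟩ := hε t (Finset.Icc_subset_Icc_right hT ht)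
  refine ⟨hmeas, fun η => ⟨(hsub η).1, (hsub η).2.trans (ae_of_all _ fun _ => ?_)⟩⟩
  have hsq := sq_le_sq.2 hR
  change Real.exp (η ^ 2 * R ^ 2 / 2) ≤ Real.exp (η ^ 2 * R' ^ 2 / 2)
  gcongr

variable {X H : Type*} [MeasurableSpace X] [NormedAddCommGroup H] [InnerProductSpace ℝ H]
  {k : X → X → ℝ} {φ : X → H} {s σ : ℝ} {Ω : Type*} {mΩ : MeasurableSpace Ω} {P : Measure Ω}
  [IsProbabilityMeasure P] {ℱ : Filtration ℕ mΩ} {x : ℕ → Ω → X} {ε : ℕ → Ω → ℝ} {n : ℕ}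

namespace IsFeatureMap

lemma lintegral_mixtureProcess_succ_le (hφ : IsFeatureMap k φ)
    (hk : Measurable (Function.uncurry k)) (hs : 0 < s) (hσ : 0 < σ)
    (hx : ∀ t ∈ Finset.Icc 1 (n + 1), Measurable[ℱ (t - 1)] (x t))
    (hε : IsCondSubGaussianNoise P ℱ σ ε (n + 1)) :
    ∫⁻ ω, ENNReal.ofReal (mixtureProcess k s (σ ^ 2) x ε (n + 1) ω) ∂P
      ≤ ∫⁻ ω, ENNReal.ofReal (mixtureProcess k s (σ ^ 2) x ε n ω) ∂P := by
  have hsubset : Finset.Icc 1 n ⊆ Finset.Icc 1 (n + 1) := Finset.Icc_subset_Icc_right n.le_succ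
  have hlast : n + 1 ∈ Finset.Icc 1 (n + 1) := Finset.right_mem_Icc.2 (by omega)
  have hx' := fun t ht => hx t (hsubset ht)
  have hε' := fun t ht => (hε t (hsubset ht)).1
  have hq : Measurable[ℱ n] (queries x n) := measurable_queries hx' n.le_succ
  have hxn : Measurable[ℱ n] (x (n + 1)) := hx (n + 1) hlast
  obtain ⟨hmeas, hsub⟩ := hε (n + 1) hlast
  have hpos (ω : Ω) : 0 ≤ mixtureProcess k s (σ ^ 2) x ε n ω := (Real.exp_pos _).le
  simp only [hφ.mixtureProcess_succ hs, ENNReal.ofReal_mul (hpos _)]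
  exact lintegral_mul_mixtureFactor_le (c := ⟨σ ^ 2, sq_nonneg σ⟩) (ℱ.le n)
    (hmeas.mono (ℱ.le _) le_rfl) (fun t => (hsub t).1)
    (fun t => (hsub t).2.trans_eq
      (ae_of_all _ fun _ => congrArg (Real.exp <| · / 2) (mul_comm _ _)))
    (fun h => (pow_pos hσ 2).ne' (congrArg NNReal.toReal h))
    (measurable_mixtureProcess hk s (σ ^ 2) hx' hε').ennreal_ofReal
    (measurable_postMean hk s hq (measurable_noise hε') hxn)
    ((measurable_postVar hk s hq hxn).div_const _)
    fun ω => div_nonneg (hφ.postVar_nonneg hs _ _) (sq_nonneg s)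

lemma lintegral_mixtureProcess_le_one (hφ : IsFeatureMap k φ)
    (hk : Measurable (Function.uncurry k)) (hs : 0 < s) (hσ : 0 < σ)
    (hx : ∀ t ∈ Finset.Icc 1 n, Measurable[ℱ (t - 1)] (x t))
    (hε : IsCondSubGaussianNoise P ℱ σ ε n) :
    ∫⁻ ω, ENNReal.ofReal (mixtureProcess k s (σ ^ 2) x ε n ω) ∂P ≤ 1 := by
  induction n with
  | zero => simp [mixtureProcess, selfNormSq, gainDet]
  | succ n ih =>
    exact (hφ.lintegral_mixtureProcess_succ_le hk hs hσ hx hε).trans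
      (ih (fun t ht => hx t (Finset.Icc_subset_Icc_right n.le_succ ht))
        (hε.mono le_rfl n.le_succ))

lemma measure_log_gainDet_add_lt_le (hφ : IsFeatureMap k φ)
    (hk : Measurable (Function.uncurry k)) (hs : 0 < s) (hσ : 0 < σ)
    (hx : ∀ t ∈ Finset.Icc 1 n, Measurable[ℱ (t - 1)] (x t))
    (hε : IsCondSubGaussianNoise P ℱ σ ε n) (u : ℝ) :
    P {ω | Real.log (gainDet k s (queries x n ω)) + 2 * u
        < selfNormSq k s (queries x n ω) (noise ε n ω) / σ ^ 2}
      ≤ ENNReal.ofReal (Real.exp (-u)) := by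
  have hmeas := measurable_mixtureProcess hk s (σ ^ 2) hx fun t ht => (hε t ht).1
  calc P {ω | Real.log (gainDet k s (queries x n ω)) + 2 * u
        < selfNormSq k s (queries x n ω) (noise ε n ω) / σ ^ 2}
      ≤ P {ω | ENNReal.ofReal (Real.exp u)
          ≤ ENNReal.ofReal (mixtureProcess k s (σ ^ 2) x ε n ω)} :=
        measure_mono fun ω (hω : (_ : ℝ) < _) =>
          ENNReal.ofReal_le_ofReal (Real.exp_le_exp.2 (by linarith))
    _ ≤ (∫⁻ ω, ENNReal.ofReal (mixtureProcess k s (σ ^ 2) x ε n ω) ∂P)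
          / ENNReal.ofReal (Real.exp u) :=
        meas_ge_le_lintegral_div (hmeas.mono (ℱ.le n) le_rfl).ennreal_ofReal.aemeasurable
          (ENNReal.ofReal_pos.2 (Real.exp_pos u)).ne' ENNReal.ofReal_ne_top
    _ ≤ 1 / ENNReal.ofReal (Real.exp u) :=
        ENNReal.div_le_div_right (hφ.lintegral_mixtureProcess_le_one hk hs hσ hx hε) _
    _ = ENNReal.ofReal (Real.exp (-u)) := by
        rw [one_div, ← ENNReal.ofReal_inv_of_pos (Real.exp_pos u), Real.exp_neg]

/-- When the trace is small, the mixture is taken with the smaller regulariser `√τ σ`, for which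
the log determinant is at most one; passing to the regulariser `σ` then gains the factor `2 τ`. -/
lemma measure_mul_lt_selfNormSq_le_of_trace_le (hφ : IsFeatureMap k φ)
    (hk : Measurable (Function.uncurry k)) (hσ : 0 < σ)
    (hx : ∀ t ∈ Finset.Icc 1 n, Measurable[ℱ (t - 1)] (x t))
    (hε : IsCondSubGaussianNoise P ℱ σ ε n) {τ : ℝ} (hτ : 0 ≤ τ)
    (htrace : ∀ a : Fin n → X, (gram k a).trace ≤ τ * σ ^ 2) (u : ℝ) :
    P {ω | 2 * τ * (1 + 2 * u) < selfNormSq k σ (queries x n ω) (noise ε n ω) / σ ^ 2}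
      ≤ ENNReal.ofReal (Real.exp (-u)) := by
  rcases hτ.eq_or_lt with rfl | hτ
  · have hgram (a : Fin n → X) : gram k a = 0 :=
      (hφ.posSemidef_gram a).trace_eq_zero_iff.1
        (((htrace a).trans_eq (zero_mul _)).antisymm (hφ.posSemidef_gram a).trace_nonneg)
    simp [selfNormSq, hgram]
  have hs : 0 < √τ * σ := mul_pos (Real.sqrt_pos.2 hτ) hσ
  have hs2 : (√τ * σ) ^ 2 = τ * σ ^ 2 := by rw [mul_pow, Real.sq_sqrt hτ.le]
  refine (measure_mono fun ω hω => ?_).trans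
    (hφ.measure_log_gainDet_add_lt_le hk hs hσ hx hε u)
  set a := queries x n ω
  set e := noise ε n ω
  have hσ2 : 0 < σ ^ 2 := pow_pos hσ 2
  have hlog : Real.log (gainDet k (√τ * σ) a) ≤ 1 :=
    (hφ.log_gainDet_le _ a).trans (div_le_one_of_le₀ (hs2 ▸ htrace a) (sq_nonneg _))
  have hcompare : selfNormSq k σ a e ≤ 2 * τ * selfNormSq k (√τ * σ) a e := by
    refine le_of_mul_le_mul_left ?_ hσ2
    calc σ ^ 2 * selfNormSq k σ a e
        ≤ selfNormSq k (√τ * σ) a e * ((√τ * σ) ^ 2 + (gram k a).trace) :=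
          hφ.selfNormSq_le_of_trace_le hσ hs a e
      _ ≤ selfNormSq k (√τ * σ) a e * (τ * σ ^ 2 + τ * σ ^ 2) := by
          have hZ := hφ.selfNormSq_nonneg hs a e
          rw [hs2]
          gcongr
          exact htrace a
      _ = σ ^ 2 * (2 * τ * selfNormSq k (√τ * σ) a e) := by ring
  have hlarge : 1 + 2 * u < selfNormSq k (√τ * σ) a e / σ ^ 2 := by
    refine lt_of_mul_lt_mul_left (hω.trans_le ?_) (by positivity : 0 ≤ 2 * τ)
    rw [← mul_div_assoc]
    gcongr
  exact (add_le_add_left hlog _).trans_lt hlarge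

lemma measure_infoGain_mul_lt_selfNormSq_le (hφ : IsFeatureMap k φ)
    (hk : Measurable (Function.uncurry k)) (hk_bdd : BddAbove (Set.range fun z => k z z))
    (hσ : 0 < σ) (hx : ∀ t ∈ Finset.Icc 1 n, Measurable[ℱ (t - 1)] (x t))
    (hε : IsCondSubGaussianNoise P ℱ σ ε n) {u : ℝ} (hu : 0 ≤ u) :
    P {ω | 8 * infoGain k σ n * (1 + 2 * u)
        < selfNormSq k σ (queries x n ω) (noise ε n ω) / σ ^ 2}
      ≤ ENNReal.ofReal (Real.exp (-u)) := by
  rcases le_total (infoGain k σ n) (1 / 2) with hγ | hγ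
  · have h := hφ.measure_mul_lt_selfNormSq_le_of_trace_le hk hσ hx hε
      (mul_nonneg (by norm_num : (0 : ℝ) ≤ 4) (hφ.infoGain_nonneg σ n))
      (hφ.trace_le_of_infoGain_le hk_bdd hσ hγ) u
    rwa [← mul_assoc, (by norm_num : (2 : ℝ) * 4 = 8)] at h
  · refine le_trans (measure_mono fun ω (hω : (_ : ℝ) < _) => ?_)
      (hφ.measure_log_gainDet_add_lt_le hk hσ hσ hx hε u)
    have hlog := hφ.half_log_gainDet_le_infoGain hk_bdd σ (queries x n ω)
    exact lt_of_le_of_lt (by nlinarith) hω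

end IsFeatureMap

end Concentration

section Coverage

variable {X H : Type*} [NormedAddCommGroup H] [InnerProductSpace ℝ H] {k : X → X → ℝ} {φ : X → H}
  {σ δ : ℝ} {Ω : Type*} {x : ℕ → Ω → X} {ε : ℕ → Ω → ℝ}

lemma IsFeatureMap.mem_coverageSet_of_selfNormSq_le (hφ : IsFeatureMap k φ) (hσ : 0 < σ) {g : H}
    {f : X → ℝ} (hf : ∀ z, f z = inner ℝ g (φ z)) {B θ : ℝ} (hg : ‖g‖ ≤ B) {β : ℕ → ℝ} {t : ℕ}
    (hβ : 2 * B ^ 2 + 2 * θ ≤ β t) {ω : Ω}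
    (hZ : selfNormSq k σ (queries x (t - 1) ω) (noise ε (t - 1) ω) / σ ^ 2 ≤ θ) (z : X) :
    f z ∈ coverageSet k σ β f x ε t ω z := by
  have hobs : observations f x ε (t - 1) ω
      = fun i => inner ℝ g (φ (queries x (t - 1) ω i)) + noise ε (t - 1) ω i :=
    funext fun _ => congrArg (· + _) (hf _)
  change |f z - postMean k σ (queries x (t - 1) ω) (observations f x ε (t - 1) ω) z| ≤ _
  rw [hobs, hf]
  refine (hφ.abs_sub_postMean_le hσ _ _ g z).trans
    (mul_le_mul_of_nonneg_right (Real.le_sqrt_of_sq_le ?_) (Real.sqrt_nonneg _))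
  set Z := selfNormSq k σ (queries x (t - 1) ω) (noise ε (t - 1) ω)
  calc (‖g‖ + √Z / σ) ^ 2 ≤ 2 * (‖g‖ ^ 2 + (√Z / σ) ^ 2) := add_sq_le
    _ = 2 * ‖g‖ ^ 2 + 2 * (Z / σ ^ 2) := by
      rw [div_pow, Real.sq_sqrt (hφ.selfNormSq_nonneg hσ _ _), mul_add]
    _ ≤ 2 * B ^ 2 + 2 * θ := by gcongr
    _ ≤ β t := hβ

lemma coverage_eq_one {β : ℕ → ℝ} {f : X → ℝ} {T : ℕ} (hT : 1 ≤ T) {ω : Ω}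
    (h : ∀ t ∈ Finset.Icc 1 T, f (x t ω) ∈ coverageSet k σ β f x ε t ω (x t ω)) :
    coverage k σ β f x ε T ω = 1 := by
  have hT0 : (T : ℝ) ≠ 0 := by positivity
  rw [coverage, Finset.sum_congr rfl fun t ht => Set.indicator_of_mem (h t ht) _]
  simp [hT0]

lemma mul_one_add_four_mul_le_cube {L : ℝ} (hL : Real.log 2 ≤ L) :
    8 * (1 + 2 * (2 * L)) ≤ 150 * L ^ 3 := by
  have hL' : 0.69 ≤ L := by linarith [Real.log_two_gt_d9]
  nlinarith [mul_nonneg (sub_nonneg.2 hL') (sq_nonneg L), mul_self_nonneg (L - 0.69)]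

lemma log_two_le_log_div (hδ : 0 < δ) (hδ1 : δ ≤ 1) {t : ℕ} (ht : 2 ≤ t) :
    Real.log 2 ≤ Real.log (t / δ) := by
  have ht' : (2 : ℝ) ≤ t := by exact_mod_cast ht
  exact Real.log_le_log two_pos (ht'.trans (le_div_self (by positivity) hδ hδ1))

lemma sum_Ioc_div_sq_le (hδ : 0 ≤ δ) (hδ1 : δ ≤ 1) (T : ℕ) :
    ∑ t ∈ Finset.Ioc 1 T, (δ / t) ^ 2 ≤ δ := by
  rcases T.eq_zero_or_pos with rfl | hT
  · simpa using hδ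
  have hsum : ∑ t ∈ Finset.Ioc 1 T, ((t : ℝ) ^ 2)⁻¹ ≤ 1 := by
    have h := sum_Ioc_inv_sq_le_sub (α := ℝ) one_ne_zero hT
    rw [Nat.cast_one, inv_one] at h
    exact h.trans (sub_le_self 1 (by positivity))
  simp only [div_eq_mul_inv, mul_pow, inv_pow, ← Finset.mul_sum]
  calc δ ^ 2 * ∑ t ∈ Finset.Ioc 1 T, ((t : ℝ) ^ 2)⁻¹ ≤ δ ^ 2 :=
        mul_le_of_le_one_right (sq_nonneg δ) hsum
    _ ≤ δ := pow_le_of_le_one hδ hδ1 two_ne_zero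

variable [MeasurableSpace X] {mΩ : MeasurableSpace Ω} {P : Measure Ω} [IsProbabilityMeasure P]
  {ℱ : Filtration ℕ mΩ}

namespace IsFeatureMap

/-- The level `u = 2 log (t / δ)` turns `exp (-u)` into `(δ / t) ^ 2`, which is summable in `t`. -/
lemma measure_infoGain_mul_log_cube_lt_selfNormSq_le (hφ : IsFeatureMap k φ)
    (hk : Measurable (Function.uncurry k)) (hk_bdd : BddAbove (Set.range fun z => k z z))
    (hσ : 0 < σ) (hδ : 0 < δ) (hδ1 : δ ≤ 1) {n : ℕ} (hn : 1 ≤ n)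
    (hx : ∀ t ∈ Finset.Icc 1 n, Measurable[ℱ (t - 1)] (x t))
    (hε : IsCondSubGaussianNoise P ℱ σ ε n) :
    P {ω | 150 * infoGain k σ (n + 1) * Real.log ((n + 1 : ℕ) / δ) ^ 3
        < selfNormSq k σ (queries x n ω) (noise ε n ω) / σ ^ 2}
      ≤ ENNReal.ofReal ((δ / (n + 1 : ℕ)) ^ 2) := by
  set L := Real.log ((n + 1 : ℕ) / δ) with hLdef
  have hL : Real.log 2 ≤ L := log_two_le_log_div hδ hδ1 (by omega)
  have hL0 : 0 ≤ 2 * L := by linarith [Real.log_pos one_lt_two]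
  have hexp : Real.exp (-(2 * L)) = (δ / (n + 1 : ℕ)) ^ 2 := by
    rw [← mul_neg, hLdef, ← Real.log_inv, inv_div, ← Nat.cast_two, ← Real.log_pow,
      Real.exp_log (by positivity)]
  have hΩ : Nonempty Ω := P.nonempty_of_neZero
  have hX : Nonempty X := hΩ.map (x 0)
  have hthreshold : 8 * infoGain k σ n * (1 + 2 * (2 * L)) ≤ 150 * infoGain k σ (n + 1) * L ^ 3 :=
    calc 8 * infoGain k σ n * (1 + 2 * (2 * L))
        = infoGain k σ n * (8 * (1 + 2 * (2 * L))) := by ring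
      _ ≤ infoGain k σ (n + 1) * (150 * L ^ 3) :=
        mul_le_mul (hφ.infoGain_le_succ hk_bdd hσ n) (mul_one_add_four_mul_le_cube hL)
          (by positivity) (hφ.infoGain_nonneg σ _)
      _ = 150 * infoGain k σ (n + 1) * L ^ 3 := by ring
  rw [← hexp]
  exact (measure_mono fun ω hω => hthreshold.trans_lt hω).trans
    (hφ.measure_infoGain_mul_lt_selfNormSq_le hk hk_bdd hσ hx hε hL0)

lemma measure_exists_lt_selfNormSq_le (hφ : IsFeatureMap k φ)
    (hk : Measurable (Function.uncurry k)) (hk_bdd : BddAbove (Set.range fun z => k z z))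
    (hσ : 0 < σ) (hδ : 0 < δ) (hδ1 : δ ≤ 1) {T : ℕ}
    (hx : ∀ t ∈ Finset.Icc 1 T, Measurable[ℱ (t - 1)] (x t))
    (hε : IsCondSubGaussianNoise P ℱ σ ε T) :
    P {ω | ∃ t ∈ Finset.Icc 1 T, 150 * infoGain k σ t * Real.log (t / δ) ^ 3
        < selfNormSq k σ (queries x (t - 1) ω) (noise ε (t - 1) ω) / σ ^ 2}
      ≤ ENNReal.ofReal δ := by
  set bad : ℕ → Set Ω := fun t => {ω | 150 * infoGain k σ t * Real.log (t / δ) ^ 3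
    < selfNormSq k σ (queries x (t - 1) ω) (noise ε (t - 1) ω) / σ ^ 2}
  have hfirst (ω : Ω) : ω ∉ bad 1 := by
    have hlog : 0 ≤ Real.log ((1 : ℕ) / δ) :=
      Real.log_nonneg ((one_le_div hδ).2 (hδ1.trans_eq Nat.cast_one.symm))
    have hthreshold := mul_nonneg (mul_nonneg (by norm_num : (0 : ℝ) ≤ 150)
      (hφ.infoGain_nonneg σ 1)) (pow_nonneg hlog 3)
    exact not_lt.2 (le_of_eq_of_le (by simp [selfNormSq]) hthreshold)
  have hlater : ∀ t ∈ Finset.Ioc 1 T, P (bad t) ≤ ENNReal.ofReal ((δ / t) ^ 2) := by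
    intro t ht
    obtain ⟨n, rfl⟩ := Nat.exists_eq_add_one.2 (one_pos.trans (Finset.mem_Ioc.1 ht).1)
    obtain ⟨hn, hnT⟩ := Finset.mem_Ioc.1 ht
    exact hφ.measure_infoGain_mul_log_cube_lt_selfNormSq_le hk hk_bdd hσ hδ hδ1 (by omega)
      (fun t ht => hx t (Finset.Icc_subset_Icc_right (by omega) ht)) (hε.mono le_rfl (by omega))
  calc P {ω | ∃ t ∈ Finset.Icc 1 T, ω ∈ bad t}
      ≤ P (⋃ t ∈ Finset.Ioc 1 T, bad t) := measure_mono fun ω ⟨t, ht, hω⟩ => by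
        have ht1 : t ≠ 1 := fun h => hfirst ω (h ▸ hω)
        have htT := Finset.mem_Icc.1 ht
        exact Set.mem_biUnion (Finset.mem_Ioc.2 ⟨by omega, htT.2⟩) hω
    _ ≤ ∑ t ∈ Finset.Ioc 1 T, P (bad t) := measure_biUnion_finset_le _ _
    _ ≤ ∑ t ∈ Finset.Ioc 1 T, ENNReal.ofReal ((δ / t) ^ 2) := Finset.sum_le_sum hlater
    _ = ENNReal.ofReal (∑ t ∈ Finset.Ioc 1 T, (δ / t) ^ 2) :=
        (ENNReal.ofReal_sum_of_nonneg fun _ _ => sq_nonneg _).symm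
    _ ≤ ENNReal.ofReal δ := ENNReal.ofReal_le_ofReal (sum_Ioc_div_sq_le hδ.le hδ1 T)

lemma le_measure_forall_selfNormSq_le (hφ : IsFeatureMap k φ)
    (hk : Measurable (Function.uncurry k)) (hk_bdd : BddAbove (Set.range fun z => k z z))
    (hσ : 0 < σ) (hδ : 0 < δ) (hδ1 : δ ≤ 1) {T : ℕ}
    (hx : ∀ t ∈ Finset.Icc 1 T, Measurable[ℱ (t - 1)] (x t))
    (hε : IsCondSubGaussianNoise P ℱ σ ε T) :
    ENNReal.ofReal (1 - δ) ≤ P {ω | ∀ t ∈ Finset.Icc 1 T,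
      selfNormSq k σ (queries x (t - 1) ω) (noise ε (t - 1) ω) / σ ^ 2
        ≤ 150 * infoGain k σ t * Real.log (t / δ) ^ 3} := by
  rw [ENNReal.ofReal_sub _ hδ.le, ENNReal.ofReal_one, tsub_le_iff_right]
  calc 1 = P Set.univ := measure_univ.symm
    _ ≤ P _ + P _ := measure_univ_le_add_compl _
    _ ≤ _ := by
      gcongr
      simpa only [Set.compl_ofPred, not_forall, not_le, exists_prop] using
        hφ.measure_exists_lt_selfNormSq_le hk hk_bdd hσ hδ hδ1 hx hε

end IsFeatureMap

end Coverage

lemma isFeatureMap_kerFun {X H : Type*} [NormedAddCommGroup H] [InnerProductSpace ℝ H]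
    [CompleteSpace H] [RKHS ℝ H X ℝ] {k : X → X → ℝ}
    (hk : ∀ z z', RKHS.kernel H z z' 1 = k z z') :
    IsFeatureMap k fun z => RKHS.kerFun H z (1 : ℝ) := by
  intro z z'
  rw [← hk, RKHS.kerFun_inner, RKHS.kerFun_apply]
  simp

lemma apply_eq_inner_kerFun {X H : Type*} [NormedAddCommGroup H] [InnerProductSpace ℝ H]
    [CompleteSpace H] [RKHS ℝ H X ℝ] (f : H) (z : X) :
    f z = inner ℝ f (RKHS.kerFun H z (1 : ℝ)) := by
  rw [RKHS.inner_kerFun]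
  simp

end GPUCB

theorem mainTheorem5_general {X H : Type*} [MeasurableSpace X] [NormedAddCommGroup H]
    [InnerProductSpace ℝ H] (k : X → X → ℝ) (hk_meas : Measurable (Function.uncurry k))
    (hk_bdd : BddAbove (Set.range fun z => k z z))
    (φ : X → H) (hφ : GPUCB.IsFeatureMap k φ)
    (g : H) (f : X → ℝ) (hf : ∀ z, f z = inner ℝ g (φ z)) (B : ℝ) (hg : ‖g‖ ≤ B)
    (σ R δ : ℝ) (hσ : 0 < σ) (hRσ : |R| ≤ σ) (hδ : 0 < δ) (hδ1 : δ ≤ 1) (T : ℕ)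
    (β : ℕ → ℝ) (hβ : ∀ t ∈ Finset.Icc 1 T, GPUCB.ucbScale k σ B δ t ≤ β t)
    {Ω : Type*} {mΩ : MeasurableSpace Ω} (P : Measure Ω) [IsProbabilityMeasure P]
    (ℱ : Filtration ℕ mΩ) (x : ℕ → Ω → X) (ε : ℕ → Ω → ℝ)
    (hx : ∀ t ∈ Finset.Icc 1 T, Measurable[ℱ (t - 1)] (x t))
    (hε : GPUCB.IsCondSubGaussianNoise P ℱ R ε T) :
    ENNReal.ofReal (1 - δ) ≤
      P {ω | ∀ t ∈ Finset.Icc 1 T, ∀ z, f z ∈ GPUCB.coverageSet k σ β f x ε t ω z} := by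
  have hε' : GPUCB.IsCondSubGaussianNoise P ℱ σ ε T :=
    hε.mono (hRσ.trans_eq (abs_of_pos hσ).symm) le_rfl
  refine (hφ.le_measure_forall_selfNormSq_le hk_meas hk_bdd hσ hδ hδ1 hx hε').trans
    (measure_mono fun ω hω t ht z => ?_)
  refine hφ.mem_coverageSet_of_selfNormSq_le hσ hf hg ?_ (hω t ht) z
  calc 2 * B ^ 2 + 2 * (150 * GPUCB.infoGain k σ t * Real.log (t / δ) ^ 3)
      = GPUCB.ucbScale k σ B δ t := by rw [GPUCB.ucbScale]; ring
    _ ≤ β t := hβ t ht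

theorem mainTheorem5 {d : ℕ} (X : Set (EuclideanSpace ℝ (Fin d))) (hX : IsCompact X)
    -- a kernel `k ≤ 1` on `X` and its reproducing kernel Hilbert space `H`
    (k : X → X → ℝ) (hk_meas : Measurable (Function.uncurry k)) (hk_le : ∀ z z', k z z' ≤ 1)
    {H : Type*} [NormedAddCommGroup H] [InnerProductSpace ℝ H] [CompleteSpace H] [RKHS ℝ H X ℝ]
    (hk : ∀ z z', RKHS.kernel H z z' 1 = k z z')
    (f : H) (B : ℝ) (hf : ‖f‖ ≤ B)
    -- noise model `σ²`, sub-Gaussian constant `R`, confidence level `δ`, exploration scale `β`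
    (σ R δ : ℝ) (hσ : 0 < σ) (hR : 0 ≤ R) (hRσ : R ≤ σ) (hδ : 0 < δ) (hδ1 : δ < 1)
    (T : ℕ) (hT : 1 ≤ T)
    (β : ℕ → ℝ) (hβ : ∀ t ∈ Finset.Icc 1 T, GPUCB.ucbScale k σ B δ t ≤ β t)
    -- a run of GP-UCB with the fixed kernel `k` for `T` rounds
    {Ω : Type*} {mΩ : MeasurableSpace Ω} (P : Measure Ω) [IsProbabilityMeasure P]
    (ℱ : Filtration ℕ mΩ) (x : ℕ → Ω → X) (ε : ℕ → Ω → ℝ)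
    (hx : ∀ t ∈ Finset.Icc 1 T, Measurable[ℱ (t - 1)] (x t))
    (hε : GPUCB.IsCondSubGaussianNoise P ℱ R ε T)
    (hucb : GPUCB.IsUCBRun k σ β (fun z => f z) x ε T) :
    ENNReal.ofReal (1 - δ) ≤
      P {ω | 1 - δ ≤ GPUCB.coverage k σ β (fun z => f z) x ε T ω} := by
  refine (mainTheorem5_general k hk_meas ⟨1, Set.forall_mem_range.2 fun z => hk_le z z⟩
    (fun z => RKHS.kerFun H z 1) (GPUCB.isFeatureMap_kerFun hk) f (fun z => f z)
    (GPUCB.apply_eq_inner_kerFun f) B hf σ R δ hσ ((abs_of_nonneg hR).trans_le hRσ) hδ hδ1.le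
    T β hβ P ℱ x ε hx hε).trans (measure_mono fun ω hω => ?_)
  have hcoverage := GPUCB.coverage_eq_one hT fun t ht => hω t ht (x t ω)
  exact (sub_le_self 1 hδ.le).trans_eq hcoverage.symm
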